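/- Let $K$ be a finite field, let $\sigma$ be an automorphism of $K$ with fixed field $F=\mathbb{F}_q$, and let $n=[K:F]$, so that $K=\mathbb{F}_{q^n}$. Let $R=K[t;\sigma]$ be the skew polynomial ring: polynomials in $t$ with coefficients in $K$ written on the left, with termwise addition and with multiplication determined by $ta=a^{\sigma}t$ for $a\in K$. Call a nonconstant $f\in R$ irreducible if there are no $a,b\in R$ with $\deg a,\deg b<\deg f$ and $f=ab$. Let $\hat h\in\mathbb{F}_q[y]$ be monic and irreducible of degree $d$ with $\hat h\ne y$, and let $h=\hat h(t^n)\in R$. Then $Rh$ is a two-sided ideal of $R$, and: 1. $R/Rh\cong M_n(\mathbb{F}_{q^d})$ as $\mathbb{F}_q$-algebras. 2. Every irreducible right divisor $f$ of $h$ in $R$ has degree $d$. 3. If $A:R/Rh\to M_n(\mathbb{F}_{q^d})$ is any ring isomorphism and $f$ is an irreducible right divisor of $h$, then the matrix $A(f+Rh)$ has rank $n-1$. -/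

import Mathlib

open Module

noncomputable section

variable {F K : Type*} [Field F] [Field K] [Algebra F K]

/-- The field `K`, made to remember an automorphism `σ`, so that it can carry the action of
`Multiplicative ℕ` by powers of `σ` which Mathlib's skew polynomials require. -/
def Twist (_σ : K ≃ₐ[F] K) : Type _ := K

namespace Twist

instance instField (σ : K ≃ₐ[F] K) : Field (Twist σ) := inferInstanceAs (Field K)

instance instAlgebra (σ : K ≃ₐ[F] K) : Algebra F (Twist σ) := inferInstanceAs (Algebra F K)

/-- The exponent `m` acts as `σ ^ m`. -/
instance instAction (σ : K ≃ₐ[F] K) : MulSemiringAction (Multiplicative ℕ) (Twist σ) :=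
  MulSemiringAction.compHom K (powersHom (K ≃ₐ[F] K) σ)

/-- The identity map `K → Twist σ`. -/
def of (σ : K ≃ₐ[F] K) : K ≃+* Twist σ := RingEquiv.refl K

theorem ofAdd_smul_of (σ : K ≃ₐ[F] K) (m : ℕ) (a : K) :
    Multiplicative.ofAdd m • of σ a = of σ ((σ ^ m) a) := rfl

end Twist

/-- The skew polynomial ring `K[t; σ]`, in which `t * a = σ a * t`. -/
abbrev SkewPoly (σ : K ≃ₐ[F] K) : Type _ := SkewPolynomial (Twist σ)

namespace SkewPoly

/-- The embedding of `K` as the constant skew polynomials. -/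
def const (σ : K ≃ₐ[F] K) : K →+* SkewPoly σ :=
  (SkewPolynomial.CRingHom : Twist σ →+* SkewPoly σ).comp (Twist.of σ : K →+* Twist σ)

/-- The indeterminate `t`. -/
def t (σ : K ≃ₐ[F] K) : SkewPoly σ := SkewPolynomial.X

/-- The degree of a skew polynomial, with `degree 0 = ⊥`. -/
def degree {σ : K ≃ₐ[F] K} (f : SkewPoly σ) : WithBot ℕ := (SkewPolynomial.support f).max

/-- A nonconstant skew polynomial is irreducible if it is not a product of two skew polynomials
of smaller degree. -/
def IsIrreducible {σ : K ≃ₐ[F] K} (f : SkewPoly σ) : Prop :=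
  0 < degree f ∧ ¬ ∃ a b : SkewPoly σ, degree a < degree f ∧ degree b < degree f ∧ f = a * b

/-- `f` divides `h` on the right. -/
def RightDvd {σ : K ≃ₐ[F] K} (f h : SkewPoly σ) : Prop := ∃ a : SkewPoly σ, h = a * f

/-- For `p ∈ F[y]`, the skew polynomial `p(t ^ n)` with `n = [K : F]`. -/
def substPow (σ : K ≃ₐ[F] K) (p : Polynomial F) : SkewPoly σ :=
  p.eval₂ ((const σ).comp (algebraMap F K)) (t σ ^ finrank F K)

theorem t_mul_const (σ : K ≃ₐ[F] K) (a : K) : t σ * const σ a = const σ (σ a) * t σ := by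
  have h := SkewPolynomial.monomial_mul_monomial 1 0 1 (Twist.of σ a)
  have h' := SkewPolynomial.monomial_mul_monomial 0 1 (Twist.of σ (σ a)) 1
  refine h.trans (Eq.trans ?_ h'.symm)
  rw [SkewPolynomial.φ_iterate_apply, Twist.ofAdd_smul_of, pow_one, Function.iterate_zero, id,
    mul_one, one_mul]

theorem t_pow_mul_const (σ : K ≃ₐ[F] K) (m : ℕ) (a : K) :
    t σ ^ m * const σ a = const σ ((σ ^ m) a) * t σ ^ m := by
  induction m generalizing a with
  | zero => simp
  | succ m ih =>
    rw [pow_succ, mul_assoc, t_mul_const, ← mul_assoc, ih, mul_assoc, pow_succ σ m,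
      AlgEquiv.mul_apply]

theorem pow_finrank_eq_one [Finite K] (σ : K ≃ₐ[F] K) : σ ^ finrank F K = 1 := by
  have : Finite F := Finite.of_injective _ (algebraMap F K).injective
  rw [← IsGalois.card_aut_eq_finrank F K]
  exact pow_card_eq_one'

/-- Since `σ ^ n = 1`, the skew polynomial `p(t ^ n)` is central. -/
theorem substPow_commute [Finite K] (σ : K ≃ₐ[F] K) (p : Polynomial F) (r : SkewPoly σ) :
    substPow σ p * r = r * substPow σ p := by
  have key : ∀ r : SkewPoly σ, (∀ c : F, Commute (const σ (algebraMap F K c)) r) →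
      Commute (t σ ^ finrank F K) r → Commute (substPow σ p) r := by
    intro r h1 h2
    rw [substPow, Polynomial.eval₂_eq_sum, Polynomial.sum_def]
    exact Finset.sum_induction _ (fun x => Commute x r) (fun _ _ => Commute.add_left)
      (Commute.zero_left r) fun i _ => (h1 _).mul_left (h2.pow_left i)
  have hc (a : K) : Commute (substPow σ p) (const σ a) := by
    refine key _ (fun c => ?_) ?_
    · rw [Commute, SemiconjBy, ← map_mul, ← map_mul, mul_comm]
    · rw [Commute, SemiconjBy, t_pow_mul_const, pow_finrank_eq_one, AlgEquiv.one_apply]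
  have ht : Commute (substPow σ p) (t σ) := by
    refine key _ (fun c => ?_) ((Commute.refl _).pow_left _)
    rw [Commute, SemiconjBy, t_mul_const, AlgEquiv.commutes]
  change Commute _ _
  induction r using SkewPolynomial.induction with
  | h0 => exact Commute.zero_right _
  | ha m a q _ _ ih =>
    refine Commute.add_right ?_ ih
    rw [← SkewPolynomial.C_mul_X_pow_eq_monomial]
    exact (hc ((Twist.of σ).symm a)).mul_right (ht.pow_right m)

/-- The left ideal `R h` for `h = p(t ^ n)`. -/
def leftIdeal (σ : K ≃ₐ[F] K) (p : Polynomial F) : Ideal (SkewPoly σ) :=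
  Ideal.span {substPow σ p}

instance leftIdeal_isTwoSided [Finite K] (σ : K ≃ₐ[F] K) (p : Polynomial F) :
    (leftIdeal σ p).IsTwoSided := by
  constructor
  intro a b ha
  rw [leftIdeal, Ideal.mem_span_singleton'] at ha ⊢
  obtain ⟨c, rfl⟩ := ha
  exact ⟨c * b, by rw [mul_assoc, mul_assoc, substPow_commute]⟩

end SkewPoly

end

/-! Write R for K[t; σ], h for p(t^n) and d for the degree of p. Everything rests on right division
with remainder plus counting: if an additive map out of R has kernel R g, its image has |K|^(deg g)
elements (`natCard_eq_of_surjective`).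

For the isomorphism, a two-sided ideal containing h has a monic generator g as a left ideal.
Comparing g * a and g * t with left multiples of g shows that g is central, hence g = γ(t^n) with γ
dividing p. As p is irreducible, R/Rh is simple. The same comparison identifies its center with the
classes of r(t^n), deg r < d, so the center has q^d elements, while R/Rh has |K|^(nd) = (q^d)^(n²).
By Artin–Wedderburn and Wedderburn's little theorem these two numbers determine a finite simple
algebra (`IsSimpleRing.nonempty_algEquiv_matrix`).

For an irreducible right divisor f, the left ideal R f is maximal. The matrix of f is singular, so
it kills some v ≠ 0, and maximality forces R f to be the whole annihilator of v. Any matrix killing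
v is then a left multiple of the matrix of f, which gives rank n - 1. Moreover r ↦ r v maps R onto
L^n with kernel R f, so q^(dn) = q^(n deg f), which gives deg f = d. -/

noncomputable section

variable {F K : Type*} [Field F] [Field K] [Algebra F K]

namespace SkewPoly

/-! ### Coefficients, leading terms and right division in K[t; σ]. -/

section Coefficients

variable {σ : K ≃ₐ[F] K}

/-- The coefficient of `t ^ i`, with coefficients written on the left. -/
def coef (f : SkewPoly σ) (i : ℕ) : K := (Twist.of σ).symm (SkewPolynomial.coeff f i)

theorem ext_coef {f g : SkewPoly σ} (h : ∀ i, coef f i = coef g i) : f = g :=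
  SkewPolynomial.ext h

@[simp] theorem coef_zero (i : ℕ) : coef (0 : SkewPoly σ) i = 0 := rfl

@[simp] theorem coef_add (f g : SkewPoly σ) (i : ℕ) : coef (f + g) i = coef f i + coef g i := by
  have h := DFunLike.congr_fun (SkewMonoidAlgebra.coeff_add f g) (Multiplicative.ofAdd i)
  exact h

/-- Taking the coefficient of `t ^ i`, as an additive map. -/
def coefHom (σ : K ≃ₐ[F] K) (i : ℕ) : SkewPoly σ →+ K where
  toFun f := coef f i
  map_zero' := rfl
  map_add' f g := coef_add f g i

@[simp] theorem coef_sub (f g : SkewPoly σ) (i : ℕ) : coef (f - g) i = coef f i - coef g i :=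
  map_sub (coefHom σ i) f g

theorem coef_sum {ι : Type*} (s : Finset ι) (f : ι → SkewPoly σ) (i : ℕ) :
    coef (∑ j ∈ s, f j) i = ∑ j ∈ s, coef (f j) i :=
  map_sum (coefHom σ i) f s

theorem const_mul_t_pow (a : K) (m : ℕ) :
    const σ a * t σ ^ m = SkewPolynomial.monomial m (Twist.of σ a) :=
  SkewPolynomial.C_mul_X_pow_eq_monomial (a := Twist.of σ a) (n := m)

theorem coef_monomial (a : K) (m i : ℕ) :
    coef (const σ a * t σ ^ m) i = if m = i then a else 0 := by
  rw [const_mul_t_pow, coef, SkewPolynomial.coeff_monomial]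
  split_ifs <;> simp

theorem coef_const (a : K) (i : ℕ) : coef (const σ a) i = if i = 0 then a else 0 := by
  simpa [eq_comm] using coef_monomial (σ := σ) a 0 i

theorem coef_t (i : ℕ) : coef (t σ) i = if i = 1 then 1 else 0 := by
  simpa [eq_comm] using coef_monomial (σ := σ) 1 1 i

theorem coef_one (i : ℕ) : coef (1 : SkewPoly σ) i = if i = 0 then 1 else 0 := by
  simpa [eq_comm] using coef_monomial (σ := σ) 1 0 i

@[elab_as_elim]
theorem monomial_induction {motive : SkewPoly σ → Prop} (f : SkewPoly σ) (zero : motive 0)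
    (add : ∀ f g, motive f → motive g → motive (f + g))
    (monomial : ∀ a m, motive (const σ a * t σ ^ m)) : motive f := by
  induction f using SkewPolynomial.induction with
  | h0 => exact zero
  | ha m a q _ _ ih =>
    refine add _ _ ?_ ih
    have := monomial ((Twist.of σ).symm a) m
    rwa [const_mul_t_pow, RingEquiv.apply_symm_apply] at this

theorem monomial_mul_monomial (a b : K) (m l : ℕ) :
    const σ a * t σ ^ m * (const σ b * t σ ^ l) =
      const σ (a * (σ ^ m) b) * t σ ^ (m + l) := by
  rw [mul_assoc, ← mul_assoc (t σ ^ m), t_pow_mul_const, map_mul, pow_add]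
  simp only [mul_assoc]

theorem coef_mul (f g : SkewPoly σ) (k : ℕ) :
    coef (f * g) k =
      ∑ x ∈ Finset.HasAntidiagonal.antidiagonal k, coef f x.1 * (σ ^ x.1) (coef g x.2) := by
  induction f using monomial_induction with
  | zero => simp
  | add f f' h h' => simp [add_mul, h, h', Finset.sum_add_distrib]
  | monomial a m =>
    induction g using monomial_induction with
    | zero => simp
    | add g g' h h' => simp [mul_add, h, h', Finset.sum_add_distrib]
    | monomial b l =>
      simp only [monomial_mul_monomial, coef_monomial]
      split_ifs with hk
      · rw [Finset.sum_eq_single (m, l)]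
        · simp
        · rintro ⟨i, j⟩ - hne
          by_cases h1 : m = i
          · have h2 : l ≠ j := fun h2 => hne (by rw [h1, h2])
            simp [h2]
          · simp [h1]
        · simp [hk]
      · refine (Finset.sum_eq_zero ?_).symm
        rintro ⟨i, j⟩ hij
        rw [Finset.HasAntidiagonal.mem_antidiagonal] at hij
        by_cases h1 : m = i
        · have h2 : l ≠ j := fun h2 => hk (by rw [h1, h2]; exact hij)
          simp [h2]
        · simp [h1]

theorem coef_const_mul (a : K) (f : SkewPoly σ) (i : ℕ) :
    coef (const σ a * f) i = a * coef f i := by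
  rw [coef_mul, Finset.sum_eq_single (0, i)]
  · simp [coef_const]
  · rintro ⟨k, l⟩ hx hne
    rw [Finset.HasAntidiagonal.mem_antidiagonal] at hx
    have : k ≠ 0 := fun h => hne (by ext <;> simp at hx ⊢ <;> omega)
    simp [coef_const, this]
  · simp

theorem coef_mul_const (a : K) (f : SkewPoly σ) (i : ℕ) :
    coef (f * const σ a) i = coef f i * (σ ^ i) a := by
  rw [coef_mul, Finset.sum_eq_single (i, 0)]
  · simp [coef_const]
  · rintro ⟨k, l⟩ hx hne
    rw [Finset.HasAntidiagonal.mem_antidiagonal] at hx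
    have : l ≠ 0 := fun h => hne (by ext <;> simp at hx ⊢ <;> omega)
    simp [coef_const, this]
  · simp

theorem coef_mul_t_zero (f : SkewPoly σ) : coef (f * t σ) 0 = 0 := by
  simp [coef_mul, coef_t]

theorem coef_mul_t_succ (f : SkewPoly σ) (i : ℕ) : coef (f * t σ) (i + 1) = coef f i := by
  rw [coef_mul, Finset.sum_eq_single (i, 1)]
  · simp [coef_t]
  · rintro ⟨k, l⟩ hx hne
    rw [Finset.HasAntidiagonal.mem_antidiagonal] at hx
    have : l ≠ 1 := fun h => hne (by ext <;> simp at hx ⊢ <;> omega)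
    simp [coef_t, this]
  · simp

theorem coef_t_mul_zero (f : SkewPoly σ) : coef (t σ * f) 0 = 0 := by
  simp [coef_mul, coef_t]

theorem coef_t_mul_succ (f : SkewPoly σ) (i : ℕ) :
    coef (t σ * f) (i + 1) = σ (coef f i) := by
  rw [coef_mul, Finset.sum_eq_single (1, i)]
  · simp [coef_t]
  · rintro ⟨k, l⟩ hx hne
    rw [Finset.HasAntidiagonal.mem_antidiagonal] at hx
    have : k ≠ 1 := fun h => hne (by ext <;> simp at hx ⊢ <;> omega)
    simp [coef_t, this]
  · simp [add_comm]

theorem coef_mul_add {f g : SkewPoly σ} {m k : ℕ} (hf : ∀ i, m < i → coef f i = 0)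
    (hg : ∀ i, k < i → coef g i = 0) :
    coef (f * g) (m + k) = coef f m * (σ ^ m) (coef g k) := by
  rw [coef_mul, Finset.sum_eq_single (m, k)]
  · rintro ⟨i, j⟩ hx hne
    rw [Finset.HasAntidiagonal.mem_antidiagonal] at hx
    simp only at hx ⊢
    rcases lt_or_ge m i with h | h
    · rw [hf i h, zero_mul]
    · have : k < j := by
        have : i ≠ m ∨ j ≠ k := by
          by_contra! h; exact hne (by rw [h.1, h.2])
        omega
      rw [hg j this, map_zero, mul_zero]
  · simp

theorem coef_mul_of_lt {f g : SkewPoly σ} {m k j : ℕ} (hf : ∀ i, m < i → coef f i = 0)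
    (hg : ∀ i, k < i → coef g i = 0) (hj : m + k < j) : coef (f * g) j = 0 := by
  rw [coef_mul]
  refine Finset.sum_eq_zero ?_
  rintro ⟨i, l⟩ hx
  rw [Finset.HasAntidiagonal.mem_antidiagonal] at hx
  simp only at hx ⊢
  rcases lt_or_ge m i with h | h
  · rw [hf i h, zero_mul]
  · rw [hg l (by omega), map_zero, mul_zero]

theorem exists_coef_bound (f : SkewPoly σ) : ∃ N, ∀ i, N ≤ i → coef f i = 0 := by
  induction f using monomial_induction with
  | zero => exact ⟨0, fun _ _ => rfl⟩
  | add f g hf hg =>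
    obtain ⟨N, hN⟩ := hf
    obtain ⟨M, hM⟩ := hg
    exact ⟨max N M, fun i hi => by
      rw [coef_add, hN i (le_of_max_le_left hi), hM i (le_of_max_le_right hi), add_zero]⟩
  | monomial a m =>
    exact ⟨m + 1, fun i hi => by rw [coef_monomial, if_neg (by omega)]⟩

theorem exists_leading {f : SkewPoly σ} (hf : f ≠ 0) :
    ∃ m, coef f m ≠ 0 ∧ ∀ i, m < i → coef f i = 0 := by
  classical
  have hex := exists_coef_bound f
  have hpos : Nat.find hex ≠ 0 := fun h =>
    hf (ext_coef fun i => Nat.find_spec hex i (by omega))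
  refine ⟨Nat.find hex - 1, fun h => ?_, fun i hi => Nat.find_spec hex i (by omega)⟩
  refine Nat.find_min hex (m := Nat.find hex - 1) (by omega) fun i hi => ?_
  rcases hi.eq_or_lt with rfl | hi
  · exact h
  · exact Nat.find_spec hex i (by omega)

theorem degree_eq_of_leading {f : SkewPoly σ} {m : ℕ} (hm : coef f m ≠ 0)
    (hf : ∀ i, m < i → coef f i = 0) : degree f = m := by
  refine le_antisymm ?_ (Finset.le_max (SkewPolynomial.mem_support_iff.2 hm))
  refine Finset.max_le fun i hi => ?_
  refine WithBot.coe_le_coe.2 ?_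
  by_contra! hlt
  exact SkewPolynomial.mem_support_iff.1 hi (hf i hlt)

theorem exists_eq_mul_add {g : SkewPoly σ} {m : ℕ} (hm : coef g m ≠ 0)
    (hg : ∀ i, m < i → coef g i = 0) (f : SkewPoly σ) :
    ∃ a r : SkewPoly σ, f = a * g + r ∧ ∀ i, m ≤ i → coef r i = 0 := by
  obtain ⟨N, hN⟩ := exists_coef_bound f
  induction N generalizing f with
  | zero => exact ⟨0, f, by simp, fun i _ => hN i (Nat.zero_le i)⟩
  | succ N ih =>
    rcases lt_or_ge N m with hlt | hle
    · exact ⟨0, f, by simp, fun i hi => hN i (by omega)⟩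
    obtain ⟨e, rfl⟩ := Nat.exists_eq_add_of_le' hle
    -- Moving t^e past the leading coefficient of g twists it by σ^e, hence the twisted denominator.
    set c := coef f (e + m) / (σ ^ e) (coef g m) with hc
    have hb : ∀ i, e < i → coef (const σ c * t σ ^ e) i = 0 := fun i hi => by
      rw [coef_monomial, if_neg (by omega)]
    obtain ⟨a, r, har, hr⟩ := ih (f - const σ c * t σ ^ e * g) fun i hi => by
      rcases hi.eq_or_lt with rfl | hi
      · rw [coef_sub, coef_mul_add hb hg, coef_monomial, if_pos rfl, hc,
          div_mul_cancel₀ _ ((map_ne_zero _).2 hm), sub_self]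
      · rw [coef_sub, hN i hi, coef_mul_of_lt hb hg hi, sub_zero]
    exact ⟨a + const σ c * t σ ^ e, r, by rw [add_mul, add_right_comm, ← har]; abel, hr⟩

theorem leading_mul {f g : SkewPoly σ} {m k : ℕ} (hm : coef f m ≠ 0)
    (hf : ∀ i, m < i → coef f i = 0) (hk : coef g k ≠ 0) (hg : ∀ i, k < i → coef g i = 0) :
    coef (f * g) (m + k) ≠ 0 ∧ ∀ i, m + k < i → coef (f * g) i = 0 := by
  refine ⟨?_, fun i hi => coef_mul_of_lt hf hg hi⟩
  rw [coef_mul_add hf hg]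
  exact mul_ne_zero hm ((map_ne_zero _).2 hk)

/-- Degrees add under multiplication, so a nonzero left multiple of g has degree at least m. This is
the uniqueness half of right division, used below to turn congruences modulo R g into equalities. -/
theorem eq_zero_of_eq_mul {g r a : SkewPoly σ} {m : ℕ} (hm : coef g m ≠ 0)
    (hg : ∀ i, m < i → coef g i = 0) (hr : ∀ i, m ≤ i → coef r i = 0) (h : r = a * g) :
    r = 0 := by
  by_cases ha : a = 0
  · rw [h, ha, zero_mul]
  obtain ⟨k, hk, hak⟩ := exists_leading ha
  exact absurd (hr (k + m) (by omega)) (h ▸ (leading_mul hk hak hm hg).1)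

/-- The remainders of degree less than m, parametrized by `Fin m → K`, form a system of
representatives modulo R g. -/
theorem natCard_eq_of_surjective [Finite K] {M : Type*} [AddCommGroup M] (φ : SkewPoly σ →+ M)
    (hφ : Function.Surjective φ) {g : SkewPoly σ} {m : ℕ} (hm : coef g m ≠ 0)
    (hg : ∀ i, m < i → coef g i = 0) (hker : ∀ r, φ r = 0 ↔ ∃ a, r = a * g) :
    Nat.card M = Nat.card K ^ m := by
  have hcoef : ∀ (c : Fin m → K) (i : ℕ),
      coef (∑ j, const σ (c j) * t σ ^ (j : ℕ)) i = if h : i < m then c ⟨i, h⟩ else 0 := by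
    intro c i
    simp only [coef_sum, coef_monomial]
    split_ifs with h
    · rw [Finset.sum_eq_single ⟨i, h⟩]
      · simp
      · intro j _ hj
        rw [if_neg fun hji => hj (Fin.ext hji)]
      · simp
    · exact Finset.sum_eq_zero fun j _ => if_neg (by omega)
  have hbij : Function.Bijective
      fun c : Fin m → K => φ (∑ j, const σ (c j) * t σ ^ (j : ℕ)) := by
    constructor
    · intro c c' hcc
      rw [← sub_eq_zero, ← map_sub, hker] at hcc
      obtain ⟨a, ha⟩ := hcc
      have h0 := eq_zero_of_eq_mul hm hg (fun i hi => by
        rw [coef_sub, hcoef, hcoef, dif_neg (by omega), dif_neg (by omega), sub_zero]) ha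
      funext j
      have := congrArg (coef · (j : ℕ)) h0
      simpa [hcoef, sub_eq_zero] using this
    · intro y
      obtain ⟨f, rfl⟩ := hφ y
      obtain ⟨a, r, rfl, hr⟩ := exists_eq_mul_add hm hg f
      refine ⟨fun j => coef r j, ?_⟩
      have : (∑ j : Fin m, const σ (coef r j) * t σ ^ (j : ℕ)) = r := by
        refine ext_coef fun i => ?_
        rw [hcoef]
        split_ifs with h
        · rfl
        · rw [hr i (by omega)]
      simp only [this, map_add, (hker (a * g)).2 ⟨a, rfl⟩, zero_add]
  rw [← Nat.card_congr (Equiv.ofBijective _ hbij), Nat.card_fun, Nat.card_fin]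

end Coefficients

end SkewPoly

/-! ### Finite fields, finite simple algebras and matrices of corank one. -/

theorem FiniteField.nonempty_algEquiv_of_natCard_eq {F D L : Type*} [Field F] [Field D] [Field L]
    [Algebra F D] [Algebra F L] [Finite D] [Finite L] (h : Nat.card D = Nat.card L) :
    Nonempty (D ≃ₐ[F] L) := by
  have : Finite F := Finite.of_injective _ (algebraMap F L).injective
  have hrank : finrank F D = finrank F L := by
    refine Nat.pow_right_injective (Finite.one_lt_card : 2 ≤ Nat.card F) ?_
    simp only [← Module.natCard_eq_pow_finrank, h]
  obtain ⟨f⟩ := FiniteField.nonempty_algHom_of_finrank_dvd (F := F) (K := D) (L := L)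
    (dvd_of_eq hrank)
  refine ⟨AlgEquiv.ofBijective f ⟨f.injective, ?_⟩⟩
  exact ((Nat.bijective_iff_injective_and_card f).2 ⟨f.injective, h⟩).surjective

theorem Matrix.natCard_center {D : Type*} [Field D] (m : ℕ) [NeZero m] :
    Nat.card (Set.center (Matrix (Fin m) (Fin m) D)) = Nat.card D := by
  rw [Matrix.center_eq_range]
  refine Nat.card_congr (Equiv.ofInjective _ fun a b hab => ?_).symm
  simpa using congrArg (fun M : Matrix (Fin m) (Fin m) D => M 0 0) hab

/-- A finite simple algebra is determined by its cardinality and that of its center. -/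
theorem IsSimpleRing.nonempty_algEquiv_matrix {F B L : Type*} [Field F] [Ring B] [Algebra F B]
    [IsSimpleRing B] [Finite B] [Field L] [Algebra F L] [Finite L] {n : ℕ}
    (hcenter : Nat.card (Set.center B) = Nat.card L)
    (hcard : Nat.card B = Nat.card L ^ (n * n)) :
    Nonempty (B ≃ₐ[F] Matrix (Fin n) (Fin n) L) := by
  have : IsArtinianRing B := inferInstance
  obtain ⟨m, hm, D, _, _, ⟨e⟩⟩ := IsSimpleRing.exists_algEquiv_matrix_divisionRing F B
  have : Finite D := by
    have : Finite (Matrix (Fin m) (Fin m) D) := Finite.of_equiv B e.toEquiv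
    exact Finite.of_surjective (fun M : Matrix (Fin m) (Fin m) D => M 0 0)
      fun d => ⟨fun _ _ => d, rfl⟩
  -- Wedderburn's little theorem: the finite division ring is commutative, so it is recovered from
  -- the center of its matrix ring.
  let _ : Field D := littleWedderburn D
  have hD : Nat.card D = Nat.card L := by
    rw [← Matrix.natCard_center m, ← hcenter]
    refine Nat.card_congr (Equiv.subtypeEquiv e.toEquiv fun b => ?_).symm
    simp only [Semigroup.mem_center_iff]
    exact ⟨fun h x => by
      obtain ⟨y, rfl⟩ := e.surjective x
      exact (map_mul e y b).symm.trans ((congrArg e (h y)).trans (map_mul e b y)),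
      fun h y => e.injective (by simpa using h (e y))⟩
  have hmn : m = n := by
    have h := hcard
    rw [Nat.card_congr e.toEquiv, Matrix, Nat.card_fun, Nat.card_fun, Nat.card_fin, hD,
      ← pow_mul] at h
    exact Nat.mul_self_inj.1 (Nat.pow_right_injective (Finite.one_lt_card : 2 ≤ Nat.card L) h)
  subst hmn
  obtain ⟨ε⟩ := FiniteField.nonempty_algEquiv_of_natCard_eq (F := F) hD
  exact ⟨e.trans ε.mapMatrix⟩

/-- If the left ideal generated by a matrix over a field is proper and maximal among annihilators
of nonzero vectors, then the matrix has corank one. -/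
theorem Matrix.exists_vec_of_maximal {L : Type*} [Field L] {n : ℕ}
    (M : Matrix (Fin n) (Fin n) L) (hM : ¬ ∃ B, B * M = 1)
    (hmax : ∀ v : Fin n → L, v ≠ 0 → M.mulVec v = 0 → ∀ N : Matrix (Fin n) (Fin n) L,
      N.mulVec v = 0 → ∃ B, N = B * M) :
    M.rank = n - 1 ∧ ∃ v : Fin n → L, v ≠ 0 ∧ M.mulVec v = 0 := by
  have hdet : M.det = 0 := by
    by_contra h
    exact hM ⟨M⁻¹, Matrix.nonsing_inv_mul M (Ne.isUnit h)⟩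
  obtain ⟨v, hv, hMv⟩ := Matrix.exists_mulVec_eq_zero_iff.2 hdet
  refine ⟨le_antisymm ?_ ?_, v, hv, hMv⟩
  · have hlt : M.rank < n := by
      have h := M.mulVecLin.finrank_range_add_finrank_ker
      rw [finrank_fin_fun] at h
      have : 0 < finrank L (LinearMap.ker M.mulVecLin) := by
        have : Nontrivial (LinearMap.ker M.mulVecLin) :=
          ⟨⟨⟨v, by simpa using hMv⟩, 0, fun h => hv (congrArg Subtype.val h)⟩⟩
        exact finrank_pos
      rw [Matrix.rank]
      omega
    omega
  -- A projection whose kernel is exactly the line of v has rank n - 1. By `hmax` it factors as B *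
  -- M, so M has at least that rank.
  · obtain ⟨φ, hφ⟩ : ∃ φ : (Fin n → L) →ₗ[L] (Fin n → L), LinearMap.ker φ = L ∙ v := by
      obtain ⟨W, hW⟩ := Submodule.exists_isCompl (L ∙ v)
      exact ⟨W.projection (L ∙ v) hW.symm, Submodule.ker_projection _⟩
    obtain ⟨B, hB⟩ := hmax v hv hMv (LinearMap.toMatrix' φ) (by
      rw [LinearMap.toMatrix'_mulVec]
      exact LinearMap.mem_ker.1 (hφ ▸ Submodule.mem_span_singleton_self v))
    have hrank : (LinearMap.toMatrix' φ).rank = n - 1 := by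
      have h := φ.finrank_range_add_finrank_ker
      rw [hφ, finrank_span_singleton hv, finrank_fin_fun] at h
      rw [Matrix.rank, ← Matrix.toLin'_apply', Matrix.toLin'_toMatrix']
      omega
    rw [← hrank, hB]
    exact Matrix.rank_mul_le_right B M

namespace SkewPoly

/-! ### Left ideals and irreducible skew polynomials. -/

section Ideals

variable {σ : K ≃ₐ[F] K}

/-- Every nonzero left ideal is generated by a monic skew polynomial. -/
theorem exists_monic_generator {J : Ideal (SkewPoly σ)} {f₀ : SkewPoly σ} (h₀ : f₀ ∈ J)
    (hne : f₀ ≠ 0) :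
    ∃ g m, g ∈ J ∧ coef g m = 1 ∧ (∀ i, m < i → coef g i = 0) ∧ ∀ f ∈ J, ∃ a, f = a * g := by
  classical
  have hex : ∃ m, ∃ f ∈ J, coef f m ≠ 0 ∧ ∀ i, m < i → coef f i = 0 := by
    obtain ⟨m, hm⟩ := exists_leading hne
    exact ⟨m, f₀, h₀, hm⟩
  obtain ⟨f, hfJ, hfm, hf⟩ := Nat.find_spec hex
  set m := Nat.find hex with hm
  have hg1 : coef (const σ (coef f m)⁻¹ * f) m = 1 := by
    rw [coef_const_mul, inv_mul_cancel₀ hfm]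
  have hg : ∀ i, m < i → coef (const σ (coef f m)⁻¹ * f) i = 0 := fun i hi => by
    rw [coef_const_mul, hf i hi, mul_zero]
  have hgJ : const σ (coef f m)⁻¹ * f ∈ J := J.mul_mem_left _ hfJ
  refine ⟨_, m, hgJ, hg1, hg, fun x hx => ?_⟩
  obtain ⟨a, r, rfl, hr⟩ := exists_eq_mul_add (hg1 ▸ one_ne_zero) hg x
  have hrJ : r ∈ J := (J.add_mem_iff_right (J.mul_mem_left a hgJ)).1 hx
  refine ⟨a, ?_⟩
  by_contra hne'
  have hr0 : r ≠ 0 := fun h => hne' (by rw [h, add_zero])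
  obtain ⟨k, hk, hrk⟩ := exists_leading hr0
  refine Nat.find_min hex (m := k) ?_ ⟨r, hrJ, hk, hrk⟩
  by_contra! hle
  exact hk (hr k hle)

/-- An irreducible skew polynomial generates a maximal left ideal. -/
theorem IsIrreducible.exists_eq_mul {f : SkewPoly σ} (hf : IsIrreducible f)
    {J : Ideal (SkewPoly σ)} (hfJ : f ∈ J) (hJ : (1 : SkewPoly σ) ∉ J) {r : SkewPoly σ}
    (hr : r ∈ J) : ∃ a, r = a * f := by
  have hf0 : f ≠ 0 := by
    rintro rfl
    exact absurd hf.1 (by simp [degree])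
  obtain ⟨g, k, hgJ, hgk, hg, hgen⟩ := exists_monic_generator hfJ hf0
  obtain ⟨a, ha⟩ := hgen f hfJ
  have ha0 : a ≠ 0 := fun h => hf0 (by rw [ha, h, zero_mul])
  obtain ⟨l, hl, hal⟩ := exists_leading ha0
  have hk0 : k ≠ 0 := by
    rintro rfl
    have : g = 1 := ext_coef fun i => by
      rw [coef_one]
      split_ifs with h
      · rw [h, hgk]
      · exact hg i (Nat.pos_of_ne_zero h)
    exact hJ (this ▸ hgJ)
  have hlead := leading_mul hl hal (hgk ▸ one_ne_zero) hg
  have hdf : degree f = ((l + k : ℕ) : WithBot ℕ) := by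
    rw [ha]; exact degree_eq_of_leading hlead.1 hlead.2
  -- Since k > 0, a cofactor a of positive degree would make f = a * g a forbidden factorization. So
  -- a is a nonzero constant, and g and f generate the same left ideal.
  have hl0 : l = 0 := by
    by_contra hl0
    refine hf.2 ⟨a, g, ?_, ?_, ha⟩
    · rw [hdf, degree_eq_of_leading hl hal]
      exact Nat.cast_lt.2 (by omega)
    · rw [hdf, degree_eq_of_leading (hgk ▸ one_ne_zero) hg]
      exact Nat.cast_lt.2 (by omega)
  subst hl0
  have hac : a = const σ (coef a 0) := ext_coef fun i => by
    rw [coef_const]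
    split_ifs with h
    · rw [h]
    · exact hal i (Nat.pos_of_ne_zero h)
  obtain ⟨x, rfl⟩ := hgen r hr
  refine ⟨x * const σ (coef a 0)⁻¹, ?_⟩
  have hinv : const σ (coef a 0)⁻¹ * a = 1 :=
    (congrArg (const σ (coef a 0)⁻¹ * ·) hac).trans (by
      simp only [← map_mul, inv_mul_cancel₀ hl, map_one])
  rw [ha, mul_assoc, ← mul_assoc _ a g, hinv, one_mul]

theorem not_exists_mul_eq_one {f : SkewPoly σ} (hf : 0 < degree f) : ¬ ∃ a, a * f = 1 := by
  rintro ⟨a, ha⟩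
  have hf0 : f ≠ 0 := by
    rintro rfl
    exact absurd hf (by simp [degree])
  obtain ⟨m, hm, hfm⟩ := exists_leading hf0
  rw [degree_eq_of_leading hm hfm] at hf
  have hm0 : 0 < m := WithBot.coe_lt_coe.1 hf
  have h1 : (1 : SkewPoly σ) = 0 := eq_zero_of_eq_mul hm hfm
    (fun i hi => by rw [coef_one, if_neg (by omega)]) ha.symm
  have := congrArg (coef · 0) h1
  simp [coef_one] at this

/-- If `f` commutes with `t` up to left multiples of `g`, both having degree at most `m`
and `g` having nonzero constant term, then `f` commutes with `t`. -/
theorem mul_t_eq_of_sub_eq_mul {f g a : SkewPoly σ} {m : ℕ} (hgm : coef g m ≠ 0)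
    (hg : ∀ i, m < i → coef g i = 0) (hg0 : coef g 0 ≠ 0) (hf : ∀ i, m < i → coef f i = 0)
    (hfm : σ (coef f m) = coef f m) (ha : f * t σ - t σ * f = a * g) : f * t σ = t σ * f := by
  -- The terms in t^(m+1) cancel because σ fixes the coefficient of t^m in f. Subtracting c * g then
  -- leaves a left multiple of g of degree less than m, which is zero. The commutator has no
  -- constant term but g does, so c = 0.
  set c := coef (f * t σ - t σ * f) m / coef g m with hc
  have hx : ∀ i, m < i → coef (f * t σ - t σ * f) i = 0 := by
    rintro (_ | i) hi
    · omega
    rw [coef_sub, coef_mul_t_succ, coef_t_mul_succ]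
    rcases (Nat.lt_succ_iff.1 hi).eq_or_lt with rfl | hi'
    · rw [hfm, sub_self]
    · rw [hf i hi', map_zero, sub_zero]
  have h0 : f * t σ - t σ * f - const σ c * g = 0 := by
    refine eq_zero_of_eq_mul hgm hg (a := a - const σ c) (fun i hi => ?_) (by rw [ha, sub_mul])
    rw [coef_sub, coef_const_mul]
    rcases hi.eq_or_lt with rfl | hi
    · rw [hc, div_mul_cancel₀ _ hgm, sub_self]
    · rw [hx i hi, hg i hi, mul_zero, sub_zero]
  have hc0 : c = 0 := by
    have := congrArg (coef · 0) h0
    simpa [coef_mul_t_zero, coef_t_mul_zero, coef_const_mul, hg0] using this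
  rwa [hc0, map_zero, zero_mul, sub_zero, sub_eq_zero] at h0

end Ideals

/-! ### Polynomials in t^n, the center, and two-sided ideals. -/

section Substitution

variable (σ : K ≃ₐ[F] K)

theorem substPow_add (p r : Polynomial F) :
    substPow σ (p + r) = substPow σ p + substPow σ r :=
  Polynomial.eval₂_add _ _

theorem substPow_zero : substPow σ (0 : Polynomial F) = 0 :=
  Polynomial.eval₂_zero _ _

theorem substPow_one : substPow σ (1 : Polynomial F) = 1 :=
  Polynomial.eval₂_one _ _

theorem substPow_mul (p r : Polynomial F) :
    substPow σ (p * r) = substPow σ p * substPow σ r :=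
  Polynomial.eval₂_mul_noncomm _ _ fun k => by
    rw [RingHom.comp_apply, Commute, SemiconjBy, t_pow_mul_const, AlgEquiv.commutes]

theorem substPow_monomial (k : ℕ) (c : F) :
    substPow σ (Polynomial.monomial k c) =
      const σ (algebraMap F K c) * t σ ^ (finrank F K * k) := by
  rw [substPow, Polynomial.eval₂_monomial, pow_mul, RingHom.comp_apply]

variable [Finite K]

theorem finrank_pos_of_finite : 0 < finrank F K :=
  have : Module.Finite F K := Module.Finite.of_finite
  finrank_pos

theorem coef_substPow (p : Polynomial F) (i : ℕ) :
    coef (substPow σ p) i =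
      if finrank F K ∣ i then algebraMap F K (p.coeff (i / finrank F K)) else 0 := by
  have hn : 0 < finrank F K := finrank_pos_of_finite
  induction p using Polynomial.induction_on' with
  | add p r hp hr =>
    rw [substPow_add, coef_add, hp, hr]
    split_ifs <;> simp
  | monomial k c =>
    rw [substPow_monomial, coef_monomial, Polynomial.coeff_monomial]
    split_ifs with h1 h2 h3 h4 h5
    · rfl
    · exact absurd (by rw [← h1, Nat.mul_div_cancel_left _ hn]) h3
    · exact absurd ⟨k, h1.symm⟩ h2
    · exact absurd (by rw [h5, Nat.mul_div_cancel' h4]) h1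
    · simp
    · rfl

theorem coef_substPow_mul (p : Polynomial F) (i : ℕ) :
    coef (substPow σ p) (finrank F K * i) = algebraMap F K (p.coeff i) := by
  rw [coef_substPow, if_pos (dvd_mul_right _ _), Nat.mul_div_cancel_left _ finrank_pos_of_finite]

theorem coef_substPow_of_lt (p : Polynomial F) {i : ℕ} (hi : finrank F K * p.natDegree < i) :
    coef (substPow σ p) i = 0 := by
  rw [coef_substPow]
  split_ifs with h
  · obtain ⟨j, rfl⟩ := h
    rw [Nat.mul_div_cancel_left _ finrank_pos_of_finite,
      Polynomial.coeff_eq_zero_of_natDegree_lt (lt_of_mul_lt_mul_left' hi), map_zero]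
  · rfl

theorem coef_substPow_of_degree_lt {p : Polynomial F} {d i : ℕ} (hp : p.degree < d)
    (hi : finrank F K * d ≤ i) : coef (substPow σ p) i = 0 := by
  rw [coef_substPow]
  split_ifs with h
  · obtain ⟨j, rfl⟩ := h
    rw [Nat.mul_div_cancel_left _ finrank_pos_of_finite,
      Polynomial.coeff_eq_zero_of_degree_lt (hp.trans_le _), map_zero]
    exact_mod_cast Nat.le_of_mul_le_mul_left hi finrank_pos_of_finite
  · rfl

theorem substPow_injective : Function.Injective (substPow σ) := fun p r h => by
  ext i
  have := congrArg (coef · (finrank F K * i)) h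
  simpa only [coef_substPow_mul, (algebraMap F K).injective.eq_iff] using this

variable {σ}

theorem coef_substPow_natDegree_ne_zero {p : Polynomial F} (hp : p ≠ 0) :
    coef (substPow σ p) (finrank F K * p.natDegree) ≠ 0 := by
  rw [coef_substPow_mul]
  exact (map_ne_zero _).2 (Polynomial.leadingCoeff_ne_zero.2 hp)

/-- By `hσ` the subgroup generated by σ has fixed field F, so Artin's theorem gives σ order exactly
n. -/
theorem finrank_dvd_of_pow_eq_one (hσ : ∀ a : K, σ a = a → a ∈ Set.range (algebraMap F K))
    {i : ℕ} (hi : ∀ a, (σ ^ i) a = a) : finrank F K ∣ i := by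
  have : Module.Finite F K := Module.Finite.of_finite
  have hord : orderOf σ = finrank F K := by
    have hbot : IntermediateField.fixedField (Subgroup.zpowers σ) = ⊥ := by
      refine le_bot_iff.1 fun x hx => IntermediateField.mem_bot.2 (hσ x ?_)
      exact hx ⟨σ, Subgroup.mem_zpowers σ⟩
    rw [← Nat.card_zpowers, ← IntermediateField.finrank_fixedField_eq_card, hbot,
      IntermediateField.finrank_bot']
  rw [← hord]
  exact orderOf_dvd_of_pow_eq_one (AlgEquiv.ext hi)

/-- The center of `K[t; σ]` consists of the skew polynomials `p(t ^ n)` with `p` over `F`. -/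
theorem exists_eq_substPow (hσ : ∀ a : K, σ a = a → a ∈ Set.range (algebraMap F K))
    {f : SkewPoly σ} (hc : ∀ a, f * const σ a = const σ a * f) (ht : f * t σ = t σ * f) :
    ∃ p : Polynomial F, f = substPow σ p := by
  have hdvd : ∀ i, coef f i ≠ 0 → finrank F K ∣ i := fun i hi =>
    finrank_dvd_of_pow_eq_one hσ fun a => by
      have := congrArg (coef · i) (hc a)
      simp only [coef_mul_const, coef_const_mul] at this
      rw [mul_comm a] at this
      exact mul_left_cancel₀ hi this
  have hfix : ∀ i, ∃ c : F, algebraMap F K c = coef f i := fun i => by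
    refine hσ _ ?_
    have := congrArg (coef · (i + 1)) ht
    simp only [coef_mul_t_succ, coef_t_mul_succ] at this
    exact this.symm
  choose c hcf using hfix
  obtain ⟨N, hN⟩ := exists_coef_bound f
  have hn : 0 < finrank F K := finrank_pos_of_finite
  refine ⟨∑ j ∈ Finset.range N, Polynomial.monomial j (c (finrank F K * j)),
    ext_coef fun i => ?_⟩
  rw [coef_substPow]
  split_ifs with h
  · obtain ⟨j, rfl⟩ := h
    rw [Nat.mul_div_cancel_left _ hn, Polynomial.finsetSum_coeff]
    simp only [Polynomial.coeff_monomial, Finset.sum_ite_eq', Finset.mem_range]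
    split_ifs with hj
    · rw [hcf]
    · rw [map_zero]
      exact hN _ ((not_lt.1 hj).trans (Nat.le_mul_of_pos_left _ hn))
  · by_contra hne
    exact h (hdvd i hne)

/-- A two-sided ideal containing `p(t ^ n)`, where `p` has nonzero constant term, is generated
by `g(t ^ n)` for a divisor `g` of `p`. -/
theorem exists_substPow_generator
    (hσ : ∀ a : K, σ a = a → a ∈ Set.range (algebraMap F K)) {J : Ideal (SkewPoly σ)}
    (hJ : ∀ x ∈ J, ∀ r, x * r ∈ J) {p : Polynomial F} (hp0 : p.coeff 0 ≠ 0)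
    (hpJ : substPow σ p ∈ J) :
    ∃ g : Polynomial F, g ∣ p ∧ substPow σ g ∈ J ∧ ∀ f ∈ J, ∃ a, f = a * substPow σ g := by
  have hh0 : coef (substPow σ p) 0 ≠ 0 := by
    have := coef_substPow_mul σ p 0
    rw [mul_zero] at this
    rw [this]
    exact (map_ne_zero _).2 hp0
  have hne : substPow σ p ≠ 0 := fun h => hh0 (by rw [h, coef_zero])
  obtain ⟨g, m, hgJ, hgm, hg, hgen⟩ := exists_monic_generator hpJ hne
  have hgm' : coef g m ≠ 0 := hgm ▸ one_ne_zero
  -- The constant term of b * g is that of b times that of g, and p(t^n) has nonzero constant term.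
  -- This excludes generators divisible by t, which need not be central.
  have hg0 : coef g 0 ≠ 0 := by
    intro h
    obtain ⟨b, hb⟩ := hgen _ hpJ
    exact hh0 (by rw [hb]; simp [coef_mul, h])
  -- As g is monic, the twist by σ^m matches the leading terms, and the difference is a left
  -- multiple of g of smaller degree. Comparing constant terms afterwards shows that the twist is
  -- trivial.
  have hca : ∀ a, g * const σ a = const σ ((σ ^ m) a) * g := fun a => by
    obtain ⟨b, hb⟩ := hgen (g * const σ a - const σ ((σ ^ m) a) * g)
      (J.sub_mem (hJ g hgJ _) (J.mul_mem_left _ hgJ))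
    refine sub_eq_zero.1 (eq_zero_of_eq_mul hgm' hg (fun i hi => ?_) hb)
    rw [coef_sub, coef_mul_const, coef_const_mul]
    rcases hi.eq_or_lt with rfl | hi
    · rw [hgm, one_mul, mul_one, sub_self]
    · rw [hg i hi, zero_mul, mul_zero, sub_zero]
  have hfix : ∀ a, (σ ^ m) a = a := fun a => by
    have := congrArg (coef · 0) (hca a)
    simp only [coef_mul_const, coef_const_mul, pow_zero, AlgEquiv.one_apply] at this
    rw [mul_comm] at this
    exact (mul_right_cancel₀ hg0 this).symm
  have ht : g * t σ = t σ * g := by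
    obtain ⟨b, hb⟩ := hgen (g * t σ - t σ * g) (J.sub_mem (hJ g hgJ _) (J.mul_mem_left _ hgJ))
    exact mul_t_eq_of_sub_eq_mul hgm' hg hg0 hg (by rw [hgm, map_one]) hb
  obtain ⟨γ, rfl⟩ := exists_eq_substPow hσ (fun a => by rw [hca, hfix]) ht
  refine ⟨γ, ?_, hgJ, hgen⟩
  have hγ : γ ≠ 0 := by
    rintro rfl
    exact hgm' (by rw [substPow_zero, coef_zero])
  -- Division over F is compatible with substituting t^n, so the remainder of p modulo γ yields an
  -- element of J of too small a degree.
  have hmod : substPow σ (p % γ) ∈ J := by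
    rw [← EuclideanDomain.div_add_mod p γ, substPow_add, substPow_mul, substPow_commute] at hpJ
    exact (J.add_mem_iff_right (J.mul_mem_left _ hgJ)).1 hpJ
  obtain ⟨b, hb⟩ := hgen _ hmod
  have h0 := eq_zero_of_eq_mul (coef_substPow_natDegree_ne_zero hγ)
    (fun i hi => coef_substPow_of_lt σ γ hi)
    (fun i hi => coef_substPow_of_degree_lt σ (d := γ.natDegree)
      (by rw [← Polynomial.degree_eq_natDegree hγ]; exact EuclideanDomain.mod_lt p hγ) hi) hb
  exact EuclideanDomain.mod_eq_zero.1 (substPow_injective σ (h0.trans (substPow_zero σ).symm))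

end Substitution

/-! ### The quotient by p(t^n): cardinality, simplicity and center. -/

section Quotient

variable [Finite K] {σ : K ≃ₐ[F] K} {p : Polynomial F}

theorem mk_eq_zero_iff (r : SkewPoly σ) :
    Ideal.Quotient.mk (leftIdeal σ p) r = 0 ↔ ∃ a, r = a * substPow σ p := by
  rw [Ideal.Quotient.eq_zero_iff_mem, leftIdeal, Ideal.mem_span_singleton']
  simp only [eq_comm]

theorem natCard_quotient (hp : p ≠ 0) :
    Nat.card (SkewPoly σ ⧸ leftIdeal σ p) = Nat.card K ^ (finrank F K * p.natDegree) :=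
  natCard_eq_of_surjective (Ideal.Quotient.mk (leftIdeal σ p)).toAddMonoidHom
    Ideal.Quotient.mk_surjective (coef_substPow_natDegree_ne_zero hp)
    (fun _ hi => coef_substPow_of_lt σ p hi) mk_eq_zero_iff

theorem coeff_zero_ne_zero (hmonic : p.Monic) (hirr : Irreducible p) (hX : p ≠ Polynomial.X) :
    p.coeff 0 ≠ 0 := fun h => by
  have h1 := (Polynomial.X_dvd_iff.2 h)
  have h2 := (Polynomial.irreducible_X (R := F)).associated_of_dvd hirr h1
  exact hX (Polynomial.eq_of_monic_of_associated hmonic Polynomial.monic_X h2.symm)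

/-- The preimage in R of a two-sided ideal is generated by g(t^n) with g dividing p; irreducibility
makes g a unit or an associate of p. -/
theorem isSimpleRing_quotient (hσ : ∀ a : K, σ a = a → a ∈ Set.range (algebraMap F K))
    (hirr : Irreducible p) (hp0 : p.coeff 0 ≠ 0) :
    IsSimpleRing (SkewPoly σ ⧸ leftIdeal σ p) := by
  have hcard : Nat.card (SkewPoly σ ⧸ leftIdeal σ p) ≠ 1 := by
    rw [natCard_quotient hirr.ne_zero]
    exact (Nat.one_lt_pow (Nat.mul_pos finrank_pos_of_finite hirr.natDegree_pos).ne'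
      Finite.one_lt_card).ne'
  have hnt : Nontrivial (SkewPoly σ ⧸ leftIdeal σ p) := by
    rw [← not_subsingleton_iff_nontrivial]
    exact fun h => hcard Nat.card_unique
  refine IsSimpleRing.of_eq_bot_or_eq_top fun I => ?_
  obtain ⟨g, hgp, hgJ, hgen⟩ := exists_substPow_generator hσ
    (J := I.asIdeal.comap (Ideal.Quotient.mk (leftIdeal σ p)))
    (fun x hx r => by
      rw [Ideal.mem_comap, TwoSidedIdeal.mem_asIdeal] at hx ⊢
      rw [map_mul]
      exact I.mul_mem_right _ _ hx) hp0
    (by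
      rw [Ideal.mem_comap, (mk_eq_zero_iff _).2 ⟨1, (one_mul _).symm⟩]
      exact zero_mem _)
  obtain ⟨s, rfl⟩ := hgp
  rcases hirr.isUnit_or_isUnit rfl with hu | hu
  · right
    obtain ⟨u, hu⟩ := hu.exists_right_inv
    rw [← TwoSidedIdeal.one_mem_iff, ← map_one (Ideal.Quotient.mk (leftIdeal σ (g * s))),
      ← substPow_one, ← hu, substPow_mul, substPow_commute]
    have := Ideal.mul_mem_left _ (substPow σ u) hgJ
    rwa [Ideal.mem_comap, TwoSidedIdeal.mem_asIdeal] at this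
  · left
    obtain ⟨u, hu⟩ := hu.exists_left_inv
    refine le_bot_iff.1 fun x hx => ?_
    obtain ⟨f, rfl⟩ := Ideal.Quotient.mk_surjective x
    obtain ⟨a, rfl⟩ := hgen f (by rwa [Ideal.mem_comap, TwoSidedIdeal.mem_asIdeal])
    rw [TwoSidedIdeal.mem_bot, mk_eq_zero_iff]
    refine ⟨a * substPow σ u, ?_⟩
    rw [mul_assoc, ← substPow_mul, mul_left_comm, hu, mul_one]

/-- A remainder f whose class is central commutes with constants and with t modulo h. Degree bounds,
and for t also the constant term of h, lift this to equality in R, so f is a polynomial in t^n over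
F of degree less than that of p. -/
theorem natCard_center_quotient (hσ : ∀ a : K, σ a = a → a ∈ Set.range (algebraMap F K))
    (hp : p ≠ 0) (hp0 : p.coeff 0 ≠ 0) :
    Nat.card (Set.center (SkewPoly σ ⧸ leftIdeal σ p)) = Nat.card F ^ p.natDegree := by
  have hlead := coef_substPow_natDegree_ne_zero (σ := σ) hp
  have hlt := fun i hi => coef_substPow_of_lt σ p (i := i) hi
  have hbij : Function.Bijective fun r : Polynomial.degreeLT F p.natDegree =>
      (⟨Ideal.Quotient.mk (leftIdeal σ p) (substPow σ r), Semigroup.mem_center_iff.2 fun x => by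
        obtain ⟨f, rfl⟩ := Ideal.Quotient.mk_surjective x
        rw [← map_mul, ← map_mul, substPow_commute]⟩ :
        Set.center (SkewPoly σ ⧸ leftIdeal σ p)) := by
    constructor
    · intro r s hrs
      have h := congrArg Subtype.val hrs
      simp only at h
      rw [← sub_eq_zero, ← map_sub, mk_eq_zero_iff] at h
      obtain ⟨a, ha⟩ := h
      have h0 := eq_zero_of_eq_mul hlead hlt (fun i hi => by
        rw [coef_sub, coef_substPow_of_degree_lt σ (Polynomial.mem_degreeLT.1 r.2) hi,
          coef_substPow_of_degree_lt σ (Polynomial.mem_degreeLT.1 s.2) hi, sub_zero]) ha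
      exact Subtype.ext (substPow_injective σ (sub_eq_zero.1 h0))
    · rintro ⟨z, hz⟩
      obtain ⟨f, rfl⟩ := Ideal.Quotient.mk_surjective z
      obtain ⟨b, f, rfl, hf⟩ := exists_eq_mul_add hlead hlt f
      have hbf : Ideal.Quotient.mk (leftIdeal σ p) (b * substPow σ p + f) =
          Ideal.Quotient.mk (leftIdeal σ p) f := by
        rw [map_add, (mk_eq_zero_iff (p := p) (b * substPow σ p)).2 ⟨b, rfl⟩, zero_add]
      have hcomm : ∀ r, ∃ a, f * r - r * f = a * substPow σ p := fun r => by
        rw [← mk_eq_zero_iff, map_sub, map_mul, map_mul, sub_eq_zero, ← hbf]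
        exact (Semigroup.mem_center_iff.1 hz _).symm
      have hc : ∀ a, f * const σ a = const σ a * f := fun a => by
        obtain ⟨b, hb⟩ := hcomm (const σ a)
        refine sub_eq_zero.1 (eq_zero_of_eq_mul hlead hlt (fun i hi => ?_) hb)
        rw [coef_sub, coef_mul_const, coef_const_mul, hf i hi, zero_mul, mul_zero, sub_zero]
      have ht : f * t σ = t σ * f := by
        obtain ⟨b, hb⟩ := hcomm (t σ)
        have hh0 : coef (substPow σ p) 0 ≠ 0 := by
          have := coef_substPow_mul σ p 0
          rw [mul_zero] at this
          rw [this]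
          exact (map_ne_zero _).2 hp0
        -- The coefficient of f in the degree of h is zero, so σ fixes it.
        refine mul_t_eq_of_sub_eq_mul hlead hlt hh0 (fun i hi => hf i hi.le) ?_ hb
        rw [hf _ le_rfl, map_zero]
      obtain ⟨r, rfl⟩ := exists_eq_substPow hσ hc ht
      refine ⟨⟨r, Polynomial.mem_degreeLT.2 ?_⟩, Subtype.ext hbf.symm⟩
      rw [Polynomial.degree_lt_iff_coeff_zero]
      intro i hi
      have := hf (finrank F K * i) (Nat.mul_le_mul_left _ hi)
      rwa [coef_substPow_mul, map_eq_zero] at this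
  refine (Nat.card_congr (Equiv.ofBijective _ hbij)).symm.trans ?_
  rw [Nat.card_congr (Polynomial.degreeLTEquiv F p.natDegree).toEquiv, Nat.card_fun, Nat.card_fin]

end Quotient

end SkewPoly

/-! ### Irreducible right divisors as matrices, and the isomorphism. -/

theorem Matrix.mulVec_surjective_of_ne_zero {L : Type*} [Field L] {n : ℕ} {v : Fin n → L}
    (hv : v ≠ 0) (w : Fin n → L) : ∃ N : Matrix (Fin n) (Fin n) L, N.mulVec v = w := by
  obtain ⟨j, hj⟩ := Function.ne_iff.1 hv
  refine ⟨Matrix.vecMulVec w (Pi.single j (v j)⁻¹), ?_⟩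
  rw [Matrix.vecMulVec_mulVec, single_dotProduct, inv_mul_cancel₀ hj]
  simp

theorem SkewPoly.degree_and_rank_of_rightDvd [Finite K] {σ : K ≃ₐ[F] K} {p : Polynomial F}
    {L : Type*} [Field L] {n d : ℕ} (hn : finrank F K = n)
    (hL : Nat.card L = Nat.card F ^ d)
    (A : (SkewPoly σ ⧸ leftIdeal σ p) ≃+* Matrix (Fin n) (Fin n) L) {f : SkewPoly σ}
    (hf : IsIrreducible f) (hdvd : RightDvd f (substPow σ p)) :
    degree f = (d : WithBot ℕ) ∧ (A (Ideal.Quotient.mk (leftIdeal σ p) f)).rank = n - 1 := by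
  have : Finite F := Finite.of_injective _ (algebraMap F K).injective
  have : Module.Finite F K := Module.Finite.of_finite
  obtain ⟨b, hb⟩ := hdvd
  let ψ : SkewPoly σ →+* Matrix (Fin n) (Fin n) L :=
    (A : (SkewPoly σ ⧸ leftIdeal σ p) →+* Matrix (Fin n) (Fin n) L).comp
      (Ideal.Quotient.mk (leftIdeal σ p))
  have hψ : Function.Surjective ψ := A.surjective.comp Ideal.Quotient.mk_surjective
  have hψ0 : ∀ r, ψ r = 0 ↔ ∃ a, r = a * substPow σ p := fun r => by
    rw [← mk_eq_zero_iff]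
    exact map_eq_zero_iff A A.injective
  have hmax : ∀ v : Fin n → L, v ≠ 0 → (ψ f).mulVec v = 0 → ∀ r,
      (ψ r).mulVec v = 0 → ∃ a, r = a * f := fun v hv hfv r hr => by
    -- The annihilator of v is a left ideal containing f but not 1, so it equals R f by maximality.
    let J : Ideal (SkewPoly σ) :=
      { carrier := {r | (ψ r).mulVec v = 0}
        add_mem' := fun {x y} (hx : _ = _) (hy : _ = _) => by
          change (ψ (x + y)).mulVec v = 0
          rw [map_add, Matrix.add_mulVec, hx, hy, add_zero]
        zero_mem' := by
          change (ψ 0).mulVec v = 0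
          rw [map_zero, Matrix.zero_mulVec]
        smul_mem' := fun c x (hx : _ = _) => by
          change (ψ (c * x)).mulVec v = 0
          rw [map_mul, ← Matrix.mulVec_mulVec, hx, Matrix.mulVec_zero] }
    refine hf.exists_eq_mul (J := J) hfv (fun h1 => hv ?_) hr
    have h1' : (ψ 1).mulVec v = 0 := h1
    rwa [map_one, Matrix.one_mulVec] at h1'
  obtain ⟨hrank, v, hv, hfv⟩ := Matrix.exists_vec_of_maximal (ψ f)
    (by
      rintro ⟨B, hB⟩
      obtain ⟨r, rfl⟩ := hψ B
      -- A left inverse of the matrix lifts to r with r * f - 1 in R h. As h = b * f, this would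
      -- make f left invertible in R despite its positive degree.
      rw [← map_mul, ← map_one ψ, ← sub_eq_zero, ← map_sub, hψ0, hb] at hB
      obtain ⟨a, ha⟩ := hB
      refine not_exists_mul_eq_one hf.1 ⟨r - a * b, ?_⟩
      rw [sub_mul, mul_assoc, ← ha, sub_sub_cancel])
    (fun v hv hfv N hN => by
      obtain ⟨r, rfl⟩ := hψ N
      obtain ⟨a, rfl⟩ := hmax v hv hfv r hN
      exact ⟨ψ a, map_mul ψ a f⟩)
  refine ⟨?_, hrank⟩
  have hf0 : f ≠ 0 := by
    rintro rfl
    exact absurd hf.1 (by simp [degree])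
  obtain ⟨m, hm, hfm⟩ := exists_leading hf0
  -- Counting the orbit map r ↦ r v, onto L^n with kernel R f, determines the degree of f.
  have hcard := natCard_eq_of_surjective
    ({ toFun := fun r => (ψ r).mulVec v
       map_zero' := by rw [map_zero, Matrix.zero_mulVec]
       map_add' := fun x y => by rw [map_add, Matrix.add_mulVec] } :
      SkewPoly σ →+ (Fin n → L))
    (fun w => by
      obtain ⟨N, hN⟩ := Matrix.mulVec_surjective_of_ne_zero hv w
      obtain ⟨r, rfl⟩ := hψ N
      exact ⟨r, hN⟩) hm hfm
    (fun r => ⟨hmax v hv hfv r, by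
      rintro ⟨a, rfl⟩
      change (ψ (a * f)).mulVec v = 0
      rw [map_mul, ← Matrix.mulVec_mulVec, hfv, Matrix.mulVec_zero]⟩)
  rw [Nat.card_fun, Nat.card_fin, hL, Module.natCard_eq_pow_finrank (K := F) (V := K), hn,
    ← pow_mul, ← pow_mul, mul_comm] at hcard
  have hdm := Nat.pow_right_injective (Finite.one_lt_card : 2 ≤ Nat.card F) hcard
  have hnpos : 0 < n := hn ▸ finrank_pos
  rw [degree_eq_of_leading hm hfm, Nat.eq_of_mul_eq_mul_left hnpos hdm]

theorem SkewPoly.exists_ringEquiv_matrix [Finite K] {σ : K ≃ₐ[F] K}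
    (hσ : ∀ a : K, σ a = a → a ∈ Set.range (algebraMap F K)) {p : Polynomial F}
    (hirr : Irreducible p) (hp0 : p.coeff 0 ≠ 0) {L : Type*} [Field L] [Algebra F L] {n : ℕ}
    (hn : finrank F K = n) (hL : Nat.card L = Nat.card F ^ p.natDegree) :
    ∃ A : (SkewPoly σ ⧸ leftIdeal σ p) ≃+* Matrix (Fin n) (Fin n) L,
      ∀ c : F, A (Ideal.Quotient.mk (leftIdeal σ p) (const σ (algebraMap F K c))) =
        algebraMap F (Matrix (Fin n) (Fin n) L) c := by
  have : Finite F := Finite.of_injective _ (algebraMap F K).injective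
  have : Module.Finite F K := Module.Finite.of_finite
  have : Finite L := Nat.finite_of_card_ne_zero (by rw [hL]; exact pow_ne_zero _ Nat.card_pos.ne')
  have hcard := natCard_quotient (σ := σ) hirr.ne_zero
  have : Finite (SkewPoly σ ⧸ leftIdeal σ p) :=
    Nat.finite_of_card_ne_zero (by rw [hcard]; exact pow_ne_zero _ Nat.card_pos.ne')
  have := isSimpleRing_quotient hσ hirr hp0
  -- Constants from F are central, being the case of constant polynomials in `substPow_commute`.
  -- With this structure an F-algebra isomorphism carries the required compatibility with constants.
  let _ : Algebra F (SkewPoly σ ⧸ leftIdeal σ p) :=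
    ((Ideal.Quotient.mk (leftIdeal σ p)).comp
      ((const σ).comp (algebraMap F K))).toAlgebra' fun c x => by
        obtain ⟨f, rfl⟩ := Ideal.Quotient.mk_surjective x
        have h := substPow_commute σ (Polynomial.C c) f
        rw [substPow, Polynomial.eval₂_C] at h
        rw [RingHom.comp_apply, ← map_mul, ← map_mul, h]
  obtain ⟨e⟩ := IsSimpleRing.nonempty_algEquiv_matrix (F := F) (L := L) (n := n)
    (B := SkewPoly σ ⧸ leftIdeal σ p)
    ((natCard_center_quotient hσ hirr.ne_zero hp0).trans hL.symm)
    (by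
      rw [hcard, hL, Module.natCard_eq_pow_finrank (K := F) (V := K), hn, ← pow_mul, ← pow_mul]
      ring_nf)
  exact ⟨e.toRingEquiv, fun c => e.commutes c⟩

end

theorem mainTheorem7 {F K : Type*} [Field F] [Field K] [Finite K] [Algebra F K]
    (σ : K ≃ₐ[F] K) (hσ : ∀ a : K, σ a = a → a ∈ Set.range (algebraMap F K))
    (q n d : ℕ) (hq : Nat.card F = q) (hn : Module.finrank F K = n)
    (p : Polynomial F) (hmonic : p.Monic) (hirr : Irreducible p) (hdeg : p.natDegree = d)
    (hX : p ≠ Polynomial.X)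
    {L : Type*} [Field L] [Algebra F L] (hL : Nat.card L = q ^ d) :
    (∃ A : (SkewPoly σ ⧸ SkewPoly.leftIdeal σ p) ≃+* Matrix (Fin n) (Fin n) L,
      ∀ c : F, A (Ideal.Quotient.mk (SkewPoly.leftIdeal σ p)
          (SkewPoly.const σ (algebraMap F K c))) =
        algebraMap F (Matrix (Fin n) (Fin n) L) c) ∧
    (∀ f : SkewPoly σ, SkewPoly.IsIrreducible f →
      SkewPoly.RightDvd f (SkewPoly.substPow σ p) → SkewPoly.degree f = (d : WithBot ℕ)) ∧
    (∀ A : (SkewPoly σ ⧸ SkewPoly.leftIdeal σ p) ≃+* Matrix (Fin n) (Fin n) L,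
      ∀ f : SkewPoly σ, SkewPoly.IsIrreducible f →
        SkewPoly.RightDvd f (SkewPoly.substPow σ p) →
        (A (Ideal.Quotient.mk (SkewPoly.leftIdeal σ p) f)).rank = n - 1) := by
  subst hq hdeg
  have hp0 := SkewPoly.coeff_zero_ne_zero hmonic hirr hX
  obtain ⟨A, hA⟩ := SkewPoly.exists_ringEquiv_matrix hσ hirr hp0 hn hL
  exact ⟨⟨A, hA⟩, fun f hf hdvd => (SkewPoly.degree_and_rank_of_rightDvd hn hL A hf hdvd).1,
    fun A f hf hdvd => (SkewPoly.degree_and_rank_of_rightDvd hn hL A hf hdvd).2⟩
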